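/- A \emph{2-dimensional systolic complex} is a simply connected simplicial complex $Y$ of dimension at most $2$ in which the link of every vertex (the graph on the neighbours of the vertex, two of them being joined if they span a triangle with it) has girth at least $6$. Let $\ast\in Y^0$ be a basepoint. The \emph{squaring} $(X_Y,\ast)$ of $(Y,\ast)$ is the based square complex with vertex set $Y^0$ whose $1$-skeleton $X_Y^1$ consists of all edges of $Y^1$ whose endpoints are not equidistant to $\ast$ in $Y^1$, and which has exactly one square attached along each embedded $4$-cycle of $X_Y^1$. For a vertex $v$, the \emph{interval} $I(\ast,v)$ is the full subcomplex of $X_Y$ induced by the union of all geodesics of $X_Y^1$ from $\ast$ to $v$. A square complex is \emph{CAT(0)} if it is simply connected and nonpositively curved, that is, the link of each of its vertices is a simple graph of girth at least $4$. \textbf{Theorem.} Let $(Y,\ast)$ be a based $2$-dimensional systolic complex. Then its squaring $(X_Y,\ast)$ has flat intervals, that is, for every vertex $v$ of $X_Y$ the interval $I(\ast,v)$ is a CAT(0) square complex. Moreover, for every vertex $v$, the $1$-skeleton of $I(\ast,v)$ contains no copy of the complete bipartite graph $K_{2,3}$. -/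

import Mathlib

namespace SimpleGraph

variable {V : Type*}

/-- Combinatorial homotopy, relative to endpoints, of edge paths in the 2-complex obtained from the
graph `G` by attaching a 2-cell along every closed walk `c` with `C c`. It is the equivalence
relation, compatible with concatenation, that is generated by removing a backtrack and by removing
the boundary walk of a 2-cell. -/
inductive EdgePathHomotopic (G : SimpleGraph V) (C : ∀ {v : V}, G.Walk v v → Prop) :
    ∀ {u v : V}, G.Walk u v → G.Walk u v → Prop
  | refl {u v : V} (p : G.Walk u v) : EdgePathHomotopic G C p p
  | symm {u v : V} {p q : G.Walk u v} :
      EdgePathHomotopic G C p q → EdgePathHomotopic G C q p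
  | trans {u v : V} {p q r : G.Walk u v} :
      EdgePathHomotopic G C p q → EdgePathHomotopic G C q r → EdgePathHomotopic G C p r
  | append {u v w : V} {p p' : G.Walk u v} {q q' : G.Walk v w} :
      EdgePathHomotopic G C p p' → EdgePathHomotopic G C q q' →
        EdgePathHomotopic G C (p.append q) (p'.append q')
  | backtrack {u v : V} (h : G.Adj u v) :
      EdgePathHomotopic G C (Walk.cons h (Walk.cons h.symm Walk.nil)) Walk.nil
  | cell {v : V} (c : G.Walk v v) : C c → EdgePathHomotopic G C c Walk.nil

/-- Simple connectedness of the 2-complex with 1-skeleton `G` and 2-cells attached along the closed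
walks in `C`: it is nonempty, path connected, and its edge-path group is trivial. -/
def EdgePathSimplyConnected (G : SimpleGraph V) (C : ∀ {v : V}, G.Walk v v → Prop) : Prop :=
  G.Connected ∧ ∀ (v : V) (p : G.Walk v v), EdgePathHomotopic G C p Walk.nil

/-- The union of (the vertex sets of) the geodesics from `u` to `v`. -/
def geodesicInterval (G : SimpleGraph V) (u v : V) : Set V :=
  {w | ∃ p : G.Walk u v, p.length = G.dist u v ∧ w ∈ p.support}

end SimpleGraph

namespace AbstractSimplicialComplex

variable {V : Type*}

open Classical in
/-- The 1-skeleton of a simplicial complex, as a simple graph. -/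
def oneSkeleton (Y : AbstractSimplicialComplex V) : SimpleGraph V where
  Adj u v := u ≠ v ∧ ({u, v} : Finset V) ∈ Y.faces
  symm := ⟨fun u v h => ⟨h.1.symm, by rw [Finset.pair_comm]; exact h.2⟩⟩
  loopless := ⟨fun _ h => h.1 rfl⟩

open Classical in
/-- The closed walks of length three around the 2-simplices. -/
def IsTriangleBoundary (Y : AbstractSimplicialComplex V) {v : V}
    (p : Y.oneSkeleton.Walk v v) : Prop :=
  ∃ (a b : V) (h₁ : Y.oneSkeleton.Adj v a) (h₂ : Y.oneSkeleton.Adj a b)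
    (h₃ : Y.oneSkeleton.Adj b v), ({v, a, b} : Finset V) ∈ Y.faces ∧
      p = .cons h₁ (.cons h₂ (.cons h₃ .nil))

open Classical in
/-- The link of a vertex `v` of a simplicial complex of dimension at most two, as a graph: its
vertices are the neighbours of `v`, two of which are adjacent when they span a triangle with `v`. -/
def linkGraph (Y : AbstractSimplicialComplex V) (v : V) :
    SimpleGraph (Y.oneSkeleton.neighborSet v) where
  Adj a b := a ≠ b ∧ ({v, a.1, b.1} : Finset V) ∈ Y.faces
  symm := ⟨fun a b h => ⟨h.1.symm, by rw [Finset.pair_comm]; exact h.2⟩⟩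
  loopless := ⟨fun _ h => h.1 rfl⟩

/-- Two-dimensional systolic complexes: simply connected simplicial complexes of dimension at most
two in which the link of every vertex has girth at least six. -/
structure IsTwoDimSystolic (Y : AbstractSimplicialComplex V) : Prop where
  dim_le : ∀ s ∈ Y.faces, s.card ≤ 3
  simplyConnected : Y.oneSkeleton.EdgePathSimplyConnected Y.IsTriangleBoundary
  six_le_girth : ∀ v : V, 6 ≤ (Y.linkGraph v).egirth

end AbstractSimplicialComplex

/-- A square complex with vertex set `V`: a simple graph together with a set of embedded 4-cycles,
to each of which one square is attached. `IsSquare a b c d` says that there is a square with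
boundary cycle `a, b, c, d`; it does not depend on the starting point or the orientation. -/
structure SquareComplex (V : Type*) where
  graph : SimpleGraph V
  IsSquare : V → V → V → V → Prop
  rotate : ∀ {a b c d : V}, IsSquare a b c d → IsSquare b c d a
  reflect : ∀ {a b c d : V}, IsSquare a b c d → IsSquare d c b a
  adj : ∀ {a b c d : V}, IsSquare a b c d → graph.Adj a b
  ne : ∀ {a b c d : V}, IsSquare a b c d → a ≠ c

namespace SquareComplex

variable {V : Type*}

/-- The closed walks of length four around the squares. -/
def IsSquareBoundary (X : SquareComplex V) {v : V} (p : X.graph.Walk v v) : Prop :=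
  ∃ (a b c : V) (h₁ : X.graph.Adj v a) (h₂ : X.graph.Adj a b) (h₃ : X.graph.Adj b c)
    (h₄ : X.graph.Adj c v), X.IsSquare v a b c ∧
      p = .cons h₁ (.cons h₂ (.cons h₃ (.cons h₄ .nil)))

/-- The underlying simple graph of the link of `v`: its vertices are the neighbours of `v` (one for
each edge at `v`), and two of them are adjacent when some square has a corner at `v` between the
corresponding edges. -/
def linkGraph (X : SquareComplex V) (v : V) : SimpleGraph (X.graph.neighborSet v) where
  Adj a b := ∃ c : V, X.IsSquare v a c b
  symm := ⟨fun _ _ ⟨c, h⟩ => ⟨c, X.rotate (X.rotate (X.rotate (X.reflect h)))⟩⟩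
  loopless := ⟨fun _ ⟨_, h⟩ => X.ne (X.rotate h) rfl⟩

/-- CAT(0) square complexes: simply connected square complexes which are nonpositively curved, that
is, in which the link of every vertex has no double edge and no cycle of length less than four. -/
structure IsCAT0 (X : SquareComplex V) : Prop where
  simplyConnected : X.graph.EdgePathSimplyConnected X.IsSquareBoundary
  link_simple : ∀ {v a b c c' : V}, X.IsSquare v a c b → X.IsSquare v a c' b → c = c'
  four_le_girth : ∀ v : V, 4 ≤ (X.linkGraph v).egirth

/-- The full subcomplex induced by a set of vertices. -/
def fullSubcomplex (X : SquareComplex V) (S : Set V) : SquareComplex S where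
  graph := X.graph.induce S
  IsSquare a b c d := X.IsSquare a b c d
  rotate h := X.rotate h
  reflect h := X.reflect h
  adj h := X.adj h
  ne h e := X.ne h (congrArg Subtype.val e)

/-- The interval `I(u, v)`: the full subcomplex induced by the union of the geodesics from `u` to
`v`. -/
def interval (X : SquareComplex V) (u v : V) : SquareComplex (X.graph.geodesicInterval u v) :=
  X.fullSubcomplex (X.graph.geodesicInterval u v)

/-- The based square complex `(X, o)` has flat intervals. -/
def HasFlatIntervals (X : SquareComplex V) (o : V) : Prop :=
  ∀ v : V, (X.interval o v).IsCAT0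

end SquareComplex

namespace AbstractSimplicialComplex

variable {V : Type*}

/-- The 1-skeleton of the squaring of `(Y, o)`: the edges of `Y` whose endpoints are not equidistant
to `o`. -/
def squaringGraph (Y : AbstractSimplicialComplex V) (o : V) : SimpleGraph V where
  Adj u v := Y.oneSkeleton.Adj u v ∧ Y.oneSkeleton.dist o u ≠ Y.oneSkeleton.dist o v
  symm := ⟨fun _ _ h => ⟨h.1.symm, h.2.symm⟩⟩
  loopless := ⟨fun _ h => h.2 rfl⟩

/-- The squaring of the based complex `(Y, o)`: exactly one square is attached to `squaringGraph`
along each embedded 4-cycle. -/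
def squaring (Y : AbstractSimplicialComplex V) (o : V) : SquareComplex V where
  graph := Y.squaringGraph o
  IsSquare a b c d :=
    ((Y.squaringGraph o).Adj a b ∧ (Y.squaringGraph o).Adj b c ∧
      (Y.squaringGraph o).Adj c d ∧ (Y.squaringGraph o).Adj d a) ∧ a ≠ c ∧ b ≠ d
  rotate := fun ⟨⟨h₁, h₂, h₃, h₄⟩, h, h'⟩ => ⟨⟨h₂, h₃, h₄, h₁⟩, h', h.symm⟩
  reflect := fun ⟨⟨h₁, h₂, h₃, h₄⟩, h, h'⟩ =>
    ⟨⟨h₃.symm, h₂.symm, h₁.symm, h₄.symm⟩, h'.symm, h.symm⟩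
  adj h := h.1.1
  ne h := h.2.1

end AbstractSimplicialComplex

-- The proof rests on two properties of the spheres of `Y` around the basepoint
-- (`HasSystolicSpheres`): distinct lower neighbours of a vertex span a triangle with it, and an
-- edge inside a sphere spans a triangle with a vertex one level lower. To derive them from the
-- girth of links, a universal cover is built sphere by sphere so that both hold in it by
-- construction. Simple connectedness yields a section of this cover, the level of a lift equals the
-- distance to the basepoint, and the properties pass to `Y`.
--
-- It follows that a vertex has at most two lower neighbours and that the ends of an edge in a
-- sphere have exactly one common lower neighbour. The core is the study of straight paths in
-- spheres. The apexes below the edges of a straight path form a straight path one edge shorter and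
-- one level lower; descending in this way shows that the ends of a straight path with several edges
-- are neither equal nor adjacent. Two vertices of an interval on the same level are equal or joined
-- by a straight path, so if distinct they have at most one common lower neighbour
-- (`eq_of_mem_descendants`).
--
-- This excludes `K_{2,3}`, hence double edges in links. A triangle in a link of the interval would
-- produce a closed path of length three or five in a link of `Y`, or contradict uniqueness of lower
-- neighbours. Simple connectedness follows by pushing walks down across squares.

universe u

/-! ### Spheres of the universal cover, built inductively -/

/-- A graph `G` with a family `T` of triangles, such that the link of every vertex has no closed
path of length three, four or five. -/
structure SimpleGraph.IsLocallySixLarge {V : Type u} (G : SimpleGraph V) (T : V → V → V → Prop) :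
    Prop where
  adj : ∀ {a b c : V}, T a b c → G.Adj a b
  rotate : ∀ {a b c : V}, T a b c → T b c a
  swap : ∀ {a b c : V}, T a b c → T b a c
  no_three : ∀ {v a b c : V}, T v a b → T v b c → T v c a → False
  no_four : ∀ {v a b c d : V}, T v a b → T v b c → T v c d → T v d a → a = c ∨ b = d
  no_five : ∀ {v a b c d e : V}, T v a b → T v b c → T v c d → T v d e → T v e a → False

namespace SimpleGraph.IsLocallySixLarge

variable {V : Type u} {G : SimpleGraph V} {T : V → V → V → Prop} {a b c : V}

theorem rotate' (hT : G.IsLocallySixLarge T) (h : T a b c) : T c a b := hT.rotate (hT.rotate h)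

theorem swap' (hT : G.IsLocallySixLarge T) (h : T a b c) : T a c b :=
  hT.swap (hT.rotate' h)

theorem reverse (hT : G.IsLocallySixLarge T) (h : T a b c) : T c b a := hT.swap (hT.rotate h)

end SimpleGraph.IsLocallySixLarge

/-- A sphere of the universal cover of a triangulated graph: its vertices `E` with their projections
to the graph, the projections of their neighbours in the preceding sphere, and the adjacency of
vertices of the sphere. -/
structure CoverLayer {V : Type u} (G : SimpleGraph V) (T : V → V → V → Prop) where
  E : Type u
  proj : E → V
  lower : E → Set V
  hor : E → E → Prop
  lower_adj : ∀ {e d}, d ∈ lower e → G.Adj (proj e) d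
  lower_triangle : ∀ {e d d'}, d ∈ lower e → d' ∈ lower e → d ≠ d' → T (proj e) d d'
  hor_symm : ∀ {e e'}, hor e e' → hor e' e
  hor_notMem : ∀ {e e'}, hor e e' → proj e' ∉ lower e
  hor_triangle : ∀ {e e'}, hor e e' → ∃ d ∈ lower e, d ∈ lower e' ∧ T (proj e) (proj e') d
  exists_hor : ∀ {e d w}, d ∈ lower e → w ∉ lower e → T (proj e) d w →
    ∃ e', hor e e' ∧ proj e' = w
  hor_unique : ∀ {e e' e''}, hor e e' → hor e e'' → proj e' = proj e'' → e' = e''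

namespace CoverLayer

variable {V : Type u} {G : SimpleGraph V} {T : V → V → V → Prop}

/-- The neighbours of a vertex of the layer that lift to the next layer. -/
def upper (L : CoverLayer G T) (e : L.E) : Set V :=
  {u | G.Adj (L.proj e) u ∧ u ∉ L.lower e ∧ ∀ d ∈ L.lower e, ¬ T (L.proj e) d u}

/-- A common lower neighbour `d` of `e` and `e'` gives the path `u`, `e`, `d` in the link of `e'`.
If `u` were not an upper neighbour of `e'`, this path would close up to length three or four. -/
theorem upper_of_hor (hT : G.IsLocallySixLarge T) (L : CoverLayer G T) {e e' : L.E} {u : V}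
    (h : L.hor e e') (hu : u ∈ L.upper e) (ht : T u (L.proj e) (L.proj e')) : u ∈ L.upper e' := by
  obtain ⟨d, hd, hd', hdt⟩ := L.hor_triangle h
  have hne : u ≠ d := fun hh => hu.2.1 (hh ▸ hd)
  have h1 : T (L.proj e') u (L.proj e) := hT.rotate' ht
  have h2 : T (L.proj e') (L.proj e) d := hT.swap hdt
  refine ⟨(hT.adj h1), ?_, ?_⟩
  · intro hmem
    exact hT.no_three h1 h2 (L.lower_triangle hd' hmem hne.symm)
  · intro d' hmem ht'
    by_cases hdd : d = d'
    · subst hdd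
      exact hT.no_three h2 ht' h1
    · rcases hT.no_four h2 (L.lower_triangle hd' hmem hdd) ht' h1 with hh | hh
      · exact L.hor_notMem (L.hor_symm h) (hh ▸ hmem)
      · exact hne hh.symm

/-- Two pairs of a vertex of the layer and an upper neighbour give the same vertex of the next
layer. -/
def nextSetoid (hT : G.IsLocallySixLarge T) (L : CoverLayer G T) :
    Setoid {p : L.E × V // p.2 ∈ L.upper p.1} where
  r p q := p.1.2 = q.1.2 ∧
    (p.1.1 = q.1.1 ∨ (L.hor p.1.1 q.1.1 ∧ T p.1.2 (L.proj p.1.1) (L.proj q.1.1)))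
  iseqv := by
    refine ⟨fun p => ⟨rfl, Or.inl rfl⟩, ?_, ?_⟩
    · rintro ⟨⟨e, u⟩, hp⟩ ⟨⟨e', u'⟩, hq⟩ ⟨h, h'⟩
      dsimp only at h h' ⊢
      subst h
      exact ⟨rfl, h'.imp Eq.symm fun h =>
        ⟨L.hor_symm h.1, hT.swap' h.2⟩⟩
    · rintro ⟨⟨e, u⟩, hp⟩ ⟨⟨e', u'⟩, hq⟩ ⟨⟨e'', u''⟩, hr⟩ ⟨h, h'⟩ ⟨k, k'⟩
      dsimp only at *
      subst h k
      refine ⟨rfl, ?_⟩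
      rcases h' with rfl | ⟨h1, h2⟩
      · exact k'
      rcases k' with rfl | ⟨k1, k2⟩
      · exact Or.inr ⟨h1, h2⟩
      -- In the link of `e'`, the path from `e` through `u` to `e''` closes up through the lower
      -- vertices `c` and `d`. Length five is excluded, so `c = d`, and length four forces `e` and
      -- `e''` to have the same projection.
      left
      obtain ⟨d, hd, hd', hdt⟩ := L.hor_triangle h1
      obtain ⟨c, hc, hc', hct⟩ := L.hor_triangle k1
      have a1 : T (L.proj e') (L.proj e) u := hT.reverse h2
      have a2 : T (L.proj e') u (L.proj e'') := hT.swap k2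
      have a3 : T (L.proj e') (L.proj e'') c := hct
      have a4 : T (L.proj e') d (L.proj e) := hT.swap' (hT.swap hdt)
      have key : L.proj e = L.proj e'' := by
        by_cases hcd : c = d
        · subst hcd
          rcases hT.no_four a1 a2 a3 a4 with hh | hh
          · exact hh
          · exact absurd hc (hh ▸ hq.2.1)
        · exact (hT.no_five a1 a2 a3 (L.lower_triangle hc hd' hcd) a4).elim
      exact L.hor_unique (L.hor_symm h1) k1 key

/-- The vertices of the next layer. -/
def NextVertex (hT : G.IsLocallySixLarge T) (L : CoverLayer G T) : Type u :=
  Quotient (L.nextSetoid hT)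

section Next

variable (hT : G.IsLocallySixLarge T) (L : CoverLayer G T)

/-- The projection of the next layer. -/
def nextProj : L.NextVertex hT → V :=
  Quotient.lift (fun p => p.1.2) fun _ _ h => h.1

/-- Adjacency of a vertex of the layer and a vertex of the next layer. -/
def Low (e : L.E) (x : L.NextVertex hT) : Prop :=
  ∃ (u : V) (h : u ∈ L.upper e), x = Quotient.mk (L.nextSetoid hT) ⟨(e, u), h⟩

variable {hT L}

theorem Low.proj_mem_upper {e : L.E} {x : L.NextVertex hT} (h : L.Low hT e x) :
    L.nextProj hT x ∈ L.upper e := by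
  obtain ⟨u, h, rfl⟩ := h
  exact h

variable (hT) in
theorem exists_low_of_mem_upper {e : L.E} {u : V} (h : u ∈ L.upper e) :
    ∃ x, L.Low hT e x ∧ L.nextProj hT x = u :=
  ⟨_, ⟨u, h, rfl⟩, rfl⟩

theorem Low.unique {e : L.E} {x y : L.NextVertex hT} (hx : L.Low hT e x) (hy : L.Low hT e y)
    (h : L.nextProj hT x = L.nextProj hT y) : x = y := by
  obtain ⟨u, hu, rfl⟩ := hx
  obtain ⟨v, hv, rfl⟩ := hy
  obtain rfl : u = v := h
  rfl

theorem Low.eq_or_hor {e e' : L.E} {x : L.NextVertex hT} (h : L.Low hT e x) (h' : L.Low hT e' x) :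
    e = e' ∨ (L.hor e e' ∧ T (L.nextProj hT x) (L.proj e) (L.proj e')) := by
  obtain ⟨u, hu, rfl⟩ := h
  obtain ⟨v, hv, hh⟩ := h'
  exact (Quotient.exact hh).2

theorem Low.of_hor {e e' : L.E} {x : L.NextVertex hT} (h : L.Low hT e x) (h' : L.hor e e')
    (ht : T (L.nextProj hT x) (L.proj e) (L.proj e')) : L.Low hT e' x := by
  obtain ⟨u, hu, rfl⟩ := h
  exact ⟨u, L.upper_of_hor hT h' hu ht, Quotient.sound ⟨rfl, Or.inr ⟨h', ht⟩⟩⟩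

theorem exists_low (x : L.NextVertex hT) : ∃ e, L.Low hT e x := by
  induction x using Quotient.inductionOn with
  | h p => exact ⟨p.1.1, p.1.2, p.2, rfl⟩

theorem Low.eq_of_proj_eq {e e' : L.E} {x : L.NextVertex hT} (h : L.Low hT e x)
    (h' : L.Low hT e' x) (hp : L.proj e = L.proj e') : e = e' := by
  rcases h.eq_or_hor h' with hh | ⟨_, ht⟩
  · exact hh
  · exact absurd hp (hT.adj (hT.rotate ht)).ne

end Next

/-- The next layer of the universal cover. -/
def next (hT : G.IsLocallySixLarge T) (L : CoverLayer G T) : CoverLayer G T where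
  E := L.NextVertex hT
  proj := L.nextProj hT
  lower x := {d | ∃ e, L.Low hT e x ∧ L.proj e = d}
  hor x y := ∃ e, L.Low hT e x ∧ L.Low hT e y ∧ T (L.proj e) (L.nextProj hT x) (L.nextProj hT y)
  lower_adj := by
    rintro x _ ⟨e, he, rfl⟩
    exact he.proj_mem_upper.1.symm
  lower_triangle := by
    rintro x _ _ ⟨e, he, rfl⟩ ⟨e', he', rfl⟩ hne
    rcases he.eq_or_hor he' with hh | hh
    · exact absurd (congrArg _ hh) hne
    · exact hh.2
  hor_symm := by
    rintro x y ⟨e, hx, hy, ht⟩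
    exact ⟨e, hy, hx, hT.swap' ht⟩
  hor_notMem := by
    rintro x y ⟨e, hx, hy, ht⟩ ⟨e', hx', hp⟩
    rcases hx.eq_or_hor hx' with rfl | ⟨hh, _⟩
    · exact (hT.adj (hT.rotate' ht)).ne hp.symm
    · obtain ⟨d, hd, _, hdt⟩ := L.hor_triangle hh
      exact hy.proj_mem_upper.2.2 d hd (hp ▸ hT.swap' hdt)
  hor_triangle := by
    rintro x y ⟨e, hx, hy, ht⟩
    exact ⟨L.proj e, ⟨e, hx, rfl⟩, ⟨e, hy, rfl⟩, hT.rotate ht⟩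
  exists_hor := by
    rintro x _ w ⟨e, hx, rfl⟩ hw ht
    have hu := hx.proj_mem_upper
    -- If `w` spanned a triangle with `e` and a vertex below `e`, it would lift to a horizontal
    -- neighbour `e'` of `e`. Then `x` would also lie above `e'`, making `w` a lower neighbour of
    -- `x`.
    have hw' : w ∈ L.upper e := by
      have h1 : w ∉ L.lower e := fun hw' => hu.2.2 w hw' (hT.swap' (hT.swap ht))
      refine ⟨hT.adj (hT.rotate ht), h1, fun d hd hdt => hw ?_⟩
      obtain ⟨e', he', rfl⟩ := L.exists_hor hd h1 hdt
      exact ⟨e', hx.of_hor he' ht, rfl⟩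
    obtain ⟨y, hy, rfl⟩ := exists_low_of_mem_upper hT hw'
    exact ⟨y, ⟨e, hx, hy, hT.swap ht⟩, rfl⟩
  hor_unique := by
    rintro x y z ⟨e, hx, hy, ht⟩ ⟨e', hx', hz, ht'⟩ hp
    rcases hx.eq_or_hor hx' with rfl | ⟨hh, ht''⟩
    · exact hy.unique hz hp
    · rw [← hp] at ht'
      exact (hT.no_three ht'' (hT.swap ht') (hT.rotate ht)).elim

/-- The layer which consists of the basepoint. -/
def base (G : SimpleGraph V) (T : V → V → V → Prop) (o : V) : CoverLayer G T where
  E := PUnit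
  proj _ := o
  lower _ := ∅
  hor _ _ := False
  lower_adj h := h.elim
  lower_triangle h := h.elim
  hor_symm h := h
  hor_notMem h := h.elim
  hor_triangle h := h.elim
  exists_hor h := h.elim
  hor_unique h := h.elim

/-- The layers of the universal cover. -/
def layer (hT : G.IsLocallySixLarge T) (o : V) : ℕ → CoverLayer G T
  | 0 => base G T o
  | n + 1 => (layer hT o n).next hT

end CoverLayer

/-! ### The universal cover and lifting of walks -/

/-- The vertices of the universal cover. -/
def CoverVertex {V : Type u} {G : SimpleGraph V} {T : V → V → V → Prop}
    (hT : G.IsLocallySixLarge T) (o : V) : Type u :=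
  Σ n, (CoverLayer.layer hT o n).E

namespace CoverVertex

variable {V : Type u} {G : SimpleGraph V} {T : V → V → V → Prop} {hT : G.IsLocallySixLarge T}
  {o : V}

/-- The projection of the universal cover. -/
def proj (x : CoverVertex hT o) : V := (CoverLayer.layer hT o x.1).proj x.2

/-- Adjacency in the universal cover. -/
inductive Rel : CoverVertex hT o → CoverVertex hT o → Prop
  | up {n : ℕ} {e : (CoverLayer.layer hT o n).E}
      {x : (CoverLayer.layer hT o n).NextVertex hT} (h : CoverLayer.Low hT _ e x) :
      Rel ⟨n, e⟩ ⟨n + 1, x⟩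
  | down {n : ℕ} {e : (CoverLayer.layer hT o n).E}
      {x : (CoverLayer.layer hT o n).NextVertex hT} (h : CoverLayer.Low hT _ e x) :
      Rel ⟨n + 1, x⟩ ⟨n, e⟩
  | hor {n : ℕ} {e e' : (CoverLayer.layer hT o n).E} (h : (CoverLayer.layer hT o n).hor e e') :
      Rel ⟨n, e⟩ ⟨n, e'⟩

theorem Rel.symm {x y : CoverVertex hT o} (h : Rel x y) : Rel y x := by
  cases h with
  | up h => exact .down h
  | down h => exact .up h
  | hor h => exact .hor (CoverLayer.hor_symm _ h)

theorem Rel.adj {x y : CoverVertex hT o} (h : Rel x y) : G.Adj x.proj y.proj := by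
  cases h with
  | up h => exact h.proj_mem_upper.1
  | down h => exact h.proj_mem_upper.1.symm
  | hor h =>
    obtain ⟨_, _, _, ht⟩ := CoverLayer.hor_triangle _ h
    exact hT.adj ht

/-- Upper neighbours are by definition those that are neither lower nor in a triangle with a lower
one, so every edge lifts as one of the three kinds. -/
theorem exists_rel (x : CoverVertex hT o) {u : V} (h : G.Adj x.proj u) :
    ∃ y, Rel x y ∧ y.proj = u := by
  obtain ⟨n, e⟩ := x
  by_cases h1 : u ∈ (CoverLayer.layer hT o n).lower e
  · cases n with
    | zero => exact h1.elim
    | succ n =>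
      obtain ⟨e', h', rfl⟩ := h1
      exact ⟨⟨n, e'⟩, .down h', rfl⟩
  by_cases h2 : ∃ d ∈ (CoverLayer.layer hT o n).lower e, T ((CoverLayer.layer hT o n).proj e) d u
  · obtain ⟨d, hd, hdt⟩ := h2
    obtain ⟨e', h', rfl⟩ := CoverLayer.exists_hor _ hd h1 hdt
    exact ⟨⟨n, e'⟩, .hor h', rfl⟩
  · push Not at h2
    obtain ⟨y, hy, rfl⟩ := CoverLayer.exists_low_of_mem_upper hT ⟨h, h1, h2⟩
    exact ⟨⟨n + 1, y⟩, .up hy, rfl⟩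

theorem mem_lower {n : ℕ} {e : (CoverLayer.layer hT o n).E}
    {x : (CoverLayer.layer hT o n).NextVertex hT} (h : CoverLayer.Low hT _ e x) :
    (CoverLayer.layer hT o n).proj e ∈ (CoverLayer.layer hT o (n + 1)).lower x :=
  ⟨e, h, rfl⟩

theorem hor_proj_notMem_upper {L : CoverLayer G T} (hT : G.IsLocallySixLarge T) {e e' : L.E}
    (h : L.hor e e') : L.proj e' ∉ L.upper e := by
  obtain ⟨d, hd, _, hdt⟩ := L.hor_triangle h
  exact fun hu => hu.2.2 d hd (hT.swap' hdt)

/-- The three kinds of neighbours have disjoint projections, and within each kind the projection is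
injective. -/
theorem Rel.unique {x y z : CoverVertex hT o} (hy : Rel x y) (hz : Rel x z)
    (h : y.proj = z.proj) : y = z := by
  cases hy with
  | up hy =>
    have hu := hy.proj_mem_upper
    cases hz with
    | up hz => rw [hy.unique hz h]
    | down hz => exact absurd (Set.mem_of_eq_of_mem h (mem_lower hz)) hu.2.1
    | hor hz => exact absurd (Set.mem_of_eq_of_mem h.symm hu) (hor_proj_notMem_upper hT hz)
  | down hy =>
    have hl := mem_lower hy
    cases hz with
    | up hz => exact absurd (Set.mem_of_eq_of_mem h.symm hl) hz.proj_mem_upper.2.1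
    | down hz => rw [hy.eq_of_proj_eq hz h]
    | hor hz => exact absurd (Set.mem_of_eq_of_mem h.symm hl) (CoverLayer.hor_notMem _ hz)
  | hor hy =>
    cases hz with
    | up hz => exact absurd (Set.mem_of_eq_of_mem h hz.proj_mem_upper) (hor_proj_notMem_upper hT hy)
    | down hz => exact absurd (Set.mem_of_eq_of_mem h (mem_lower hz)) (CoverLayer.hor_notMem _ hy)
    | hor hz => rw [CoverLayer.hor_unique _ hy hz h]

end CoverVertex

namespace CoverVertex

variable {V : Type u} {G : SimpleGraph V} {T : V → V → V → Prop} {hT : G.IsLocallySixLarge T}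
  {o : V}

/-- Triangles lift to triangles, which makes lifting invariant under homotopy. In the cases not
settled by the construction of the layers, a failure would close a path of length three or four in
the link of `x`. -/
theorem Rel.triangle {x y z : CoverVertex hT o} (hy : Rel x y) (hz : Rel x z)
    (h : T x.proj y.proj z.proj) : Rel y z := by
  cases hy with
  | up hy =>
    have hu := hy.proj_mem_upper
    cases hz with
    | up hz => exact .hor ⟨_, hy, hz, h⟩
    | down hz => exact absurd (hT.swap' h) (hu.2.2 _ (mem_lower hz))
    | hor hz => exact .down (hy.of_hor hz (hT.swap h))
  | down hy =>
    have hl := mem_lower hy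
    cases hz with
    | up hz => exact absurd h (hz.proj_mem_upper.2.2 _ hl)
    | down hz =>
      rcases hy.eq_or_hor hz with rfl | hh
      · exact absurd rfl (hT.adj (hT.rotate h)).ne
      · exact .hor hh.1
    | hor hz =>
      obtain ⟨e, he, he', ht⟩ := hz
      rcases hy.eq_or_hor he with rfl | hh
      · exact .up he'
      · exact (hT.no_three h (hT.rotate ht) (hT.swap' hh.2)).elim
  | hor hy =>
    cases hz with
    | up hz => exact .up (hz.of_hor hy (hT.rotate' h))
    | down hz =>
      obtain ⟨e, he, he', ht⟩ := hy
      rcases hz.eq_or_hor he with rfl | hh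
      · exact .down he'
      · exact (hT.no_three (hT.swap' h) (hT.rotate ht) (hT.swap' hh.2)).elim
    | hor hz =>
      obtain ⟨d, hd, _, hdt⟩ := CoverLayer.hor_triangle _ hy
      obtain ⟨c, hc, _, hct⟩ := CoverLayer.hor_triangle _ hz
      by_cases hcd : c = d
      · subst hcd
        exact (hT.no_three h hct (hT.swap' hdt)).elim
      · rcases hT.no_four h hct (CoverLayer.lower_triangle _ hc hd hcd) (hT.swap' hdt) with hh | hh
        · exact absurd (Set.mem_of_eq_of_mem hh hc) (CoverLayer.hor_notMem _ hy)
        · exact absurd (Set.mem_of_eq_of_mem hh hd) (CoverLayer.hor_notMem _ hz)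

open Classical in
/-- The lift of an edge from the projection of `x` to `u`. -/
noncomputable def step (x : CoverVertex hT o) (u : V) : CoverVertex hT o :=
  if h : G.Adj x.proj u then (exists_rel x h).choose else x

theorem rel_step (x : CoverVertex hT o) {u : V} (h : G.Adj x.proj u) : Rel x (x.step u) := by
  rw [step, dif_pos h]
  exact (exists_rel x h).choose_spec.1

theorem proj_step (x : CoverVertex hT o) {u : V} (h : G.Adj x.proj u) : (x.step u).proj = u := by
  rw [step, dif_pos h]
  exact (exists_rel x h).choose_spec.2

theorem Rel.step_eq {x y : CoverVertex hT o} (h : Rel x y) : x.step y.proj = y :=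
  (rel_step x h.adj).unique h (proj_step x h.adj)

/-- The end of the lift of a walk. -/
noncomputable def lift : ∀ {u v : V}, CoverVertex hT o → G.Walk u v → CoverVertex hT o
  | _, _, x, .nil => x
  | _, _, x, .cons (v := w) _ p => lift (x.step w) p

theorem proj_lift {u v : V} (x : CoverVertex hT o) (p : G.Walk u v) (hx : x.proj = u) :
    (x.lift p).proj = v := by
  induction p generalizing x with
  | nil => exact hx
  | cons h p ih => exact ih _ (proj_step x (hx ▸ h))

theorem lift_append {u v w : V} (x : CoverVertex hT o) (p : G.Walk u v) (q : G.Walk v w) :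
    x.lift (p.append q) = (x.lift p).lift q := by
  induction p generalizing x with
  | nil => rfl
  | cons h p ih => exact ih _ _

theorem lift_eq_of_homotopic {C : ∀ {v : V}, G.Walk v v → Prop}
    (hC : ∀ {v : V} (c : G.Walk v v), C c → ∃ (a b : V) (h₁ : G.Adj v a) (h₂ : G.Adj a b)
      (h₃ : G.Adj b v), T v a b ∧ c = .cons h₁ (.cons h₂ (.cons h₃ .nil)))
    {u v : V} {p q : G.Walk u v} (h : G.EdgePathHomotopic C p q) (x : CoverVertex hT o)
    (hx : x.proj = u) : x.lift p = x.lift q := by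
  induction h generalizing x with
  | refl => rfl
  | symm _ ih => exact (ih x hx).symm
  | trans _ _ ih ih' => exact (ih x hx).trans (ih' x hx)
  | append _ _ ih ih' => rw [lift_append, lift_append, ih x hx, ih' _ (proj_lift x _ hx)]
  | @backtrack u w h =>
    subst hx
    exact (Rel.step_eq (rel_step x h).symm)
  | cell c hc =>
    obtain ⟨a, b, h₁, h₂, h₃, ht, rfl⟩ := hC c hc
    subst hx
    have e1 := proj_step x h₁
    have e2 := proj_step x h₃.symm
    have h : Rel (x.step a) (x.step b) :=
      (rel_step x h₁).triangle (rel_step x h₃.symm) (by rwa [e1, e2])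
    have h3 : (x.step a).step b = x.step b := by simpa only [e2] using h.step_eq
    change ((x.step a).step b).step x.proj = x
    rw [h3]
    exact (rel_step x h₃.symm).symm.step_eq

theorem Rel.fst_le {x y : CoverVertex hT o} (h : Rel x y) : y.1 ≤ x.1 + 1 := by
  cases h <;> dsimp only <;> omega

theorem exists_rel_fst {x : CoverVertex hT o} (hx : x.1 ≠ 0) : ∃ y, Rel x y ∧ y.1 + 1 = x.1 := by
  obtain ⟨n, e⟩ := x
  cases n with
  | zero => exact absurd rfl hx
  | succ n =>
    obtain ⟨e', h⟩ := CoverLayer.exists_low e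
    exact ⟨⟨n, e'⟩, .down h, rfl⟩

theorem Rel.lower_triangle {x y z : CoverVertex hT o} (hy : Rel x y) (hz : Rel x z)
    (hyx : y.1 + 1 = x.1) (hzx : z.1 + 1 = x.1) (hne : y.proj ≠ z.proj) :
    T x.proj y.proj z.proj := by
  cases hy with
  | up hy => dsimp only at hyx; omega
  | hor hy => dsimp only at hyx; omega
  | down hy =>
    cases hz with
    | up hz => dsimp only at hzx; omega
    | hor hz => dsimp only at hzx; omega
    | down hz => exact CoverLayer.lower_triangle _ (mem_lower hy) (mem_lower hz) hne

theorem Rel.exists_common_lower {x y : CoverVertex hT o} (h : Rel x y) (hxy : x.1 = y.1) :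
    ∃ z, Rel x z ∧ Rel y z ∧ z.1 + 1 = x.1 ∧ T x.proj y.proj z.proj := by
  cases h with
  | up h => dsimp only at hxy; omega
  | down h => dsimp only at hxy; omega
  | @hor n e e' h =>
    cases n with
    | zero => exact h.elim
    | succ n =>
      obtain ⟨f, hf, hf', ht⟩ := h
      exact ⟨⟨n, f⟩, .down hf, .down hf', rfl, hT.rotate ht⟩

end CoverVertex

/-! ### From the cover to the spheres of a simply connected complex -/

namespace SimpleGraph

variable {V : Type u} {G : SimpleGraph V}

/-- Growth by at most one along edges bounds `f` by the distance; following the descent produces a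
walk of length `f v`. -/
theorem dist_eq_of_descent {o : V} {f : V → ℕ} (ho : f o = 0)
    (hf : ∀ {u v}, G.Adj u v → f v ≤ f u + 1)
    (hd : ∀ v, f v ≠ 0 → ∃ u, G.Adj v u ∧ f u + 1 = f v) (h0 : ∀ v, f v = 0 → v = o) (v : V) :
    G.dist o v = f v := by
  have h1 : ∀ {u v : V} (p : G.Walk u v), f v ≤ f u + p.length := by
    intro u v p
    induction p with
    | nil => simp
    | cons h p ih => have := hf h; rw [Walk.length_cons]; omega
  have h2 : ∀ n v, f v = n → ∃ p : G.Walk v o, p.length = n := by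
    intro n
    induction n with
    | zero =>
      intro v hv
      obtain rfl := h0 v hv
      exact ⟨.nil, rfl⟩
    | succ n ih =>
      intro v hv
      obtain ⟨u, hu, huv⟩ := hd v (by omega)
      obtain ⟨p, hp⟩ := ih u (by omega)
      exact ⟨.cons hu p, by rw [Walk.length_cons, hp]⟩
  obtain ⟨p, hp⟩ := h2 _ v rfl
  refine le_antisymm ?_ ?_
  · rw [dist_comm, ← hp]
    exact dist_le p
  · have hr : G.Reachable o v := ⟨p.reverse⟩
    obtain ⟨q, hq⟩ := hr.exists_walk_length_eq_dist
    have := h1 q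
    omega

/-- The spheres around `o` are locally as in a systolic complex: the lower neighbours of a vertex
span a simplex with it, and an edge in a sphere spans a triangle with a lower vertex. -/
structure HasSystolicSpheres (G : SimpleGraph V) (T : V → V → V → Prop) (o : V) : Prop where
  lower_triangle : ∀ {v d d' : V}, G.Adj v d → G.Adj v d' → G.dist o d + 1 = G.dist o v →
    G.dist o d' + 1 = G.dist o v → d ≠ d' → T v d d'
  exists_common_lower : ∀ {u v : V}, G.Adj u v → G.dist o u = G.dist o v →
    ∃ d, G.Adj u d ∧ G.Adj v d ∧ G.dist o d + 1 = G.dist o u ∧ T u v d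

/-- By simple connectedness the end of a lift depends only on the end of the walk, so lifting walks
from `o` defines a section `s` that maps edges to edges. Levels in the cover then agree with
distances from `o`, and the structure of the layers can be read off in `G`. -/
theorem IsLocallySixLarge.hasSystolicSpheres {T : V → V → V → Prop} (hT : G.IsLocallySixLarge T)
    {C : ∀ {v : V}, G.Walk v v → Prop}
    (hC : ∀ {v : V} (c : G.Walk v v), C c → ∃ (a b : V) (h₁ : G.Adj v a) (h₂ : G.Adj a b)
      (h₃ : G.Adj b v), T v a b ∧ c = .cons h₁ (.cons h₂ (.cons h₃ .nil)))
    (hG : G.EdgePathSimplyConnected C) (o : V) : G.HasSystolicSpheres T o := by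
  let x₀ : CoverVertex hT o := ⟨0, PUnit.unit⟩
  have hx₀ : x₀.proj = o := rfl
  have hwalk : ∀ {v : V} (p q : G.Walk o v), x₀.lift p = x₀.lift q := by
    intro v p q
    have h1 := CoverVertex.lift_eq_of_homotopic hC (hG.2 o (p.append q.reverse)) x₀ hx₀
    have h2 := CoverVertex.lift_eq_of_homotopic hC (hG.2 v (q.reverse.append q)) (x₀.lift p)
      (CoverVertex.proj_lift _ _ hx₀)
    rw [CoverVertex.lift_append] at h1 h2
    rw [h1] at h2
    exact h2.symm
  let p' (v : V) : G.Walk o v := (hG.1.preconnected o v).some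
  let s (v : V) : CoverVertex hT o := x₀.lift (p' v)
  have hs : ∀ v, (s v).proj = v := fun v => CoverVertex.proj_lift _ _ hx₀
  have hrel : ∀ {u v : V}, G.Adj u v → CoverVertex.Rel (s u) (s v) := by
    intro u v h
    have h1 : s v = (s u).step v := by
      exact (hwalk (p' v) ((p' u).append (.cons h .nil))).trans (CoverVertex.lift_append _ _ _)
    rw [h1]
    exact CoverVertex.rel_step _ ((hs u).symm ▸ h)
  have hproj : ∀ {u : V} {y : CoverVertex hT o}, CoverVertex.Rel (s u) y → s y.proj = y := by
    intro u y h
    have h1 := h.adj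
    rw [hs] at h1
    exact (hrel h1).unique h (hs _)
  have hlift : ∀ v, (s v).1 = G.dist o v := by
    intro v
    refine (dist_eq_of_descent (f := fun v => (s v).1) ?_ ?_ ?_ ?_ v).symm
    · rw [show s o = x₀ from hwalk (p' o) .nil]
    · exact fun h => (hrel h).fst_le
    · intro v hv
      obtain ⟨y, hy, hy'⟩ := CoverVertex.exists_rel_fst hv
      have h1 := hy.adj
      rw [hs] at h1
      refine ⟨y.proj, h1, ?_⟩
      rw [hproj hy]
      exact hy'
    · intro v hv
      rw [← hs v]
      generalize s v = x at hv
      obtain ⟨n, e⟩ := x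
      dsimp only at hv
      subst hv
      rfl
  constructor
  · intro v d d' hd hd' h h' hne
    have := (hrel hd).lower_triangle (hrel hd') (by rw [hlift, hlift, h]) (by rw [hlift, hlift, h'])
      (by rwa [hs, hs])
    rwa [hs, hs, hs] at this
  · intro u v huv h
    obtain ⟨z, hz, hz', hzu, ht⟩ := (hrel huv).exists_common_lower (by rw [hlift, hlift, h])
    have h1 := hz.adj
    have h2 := hz'.adj
    rw [hs] at h1 h2
    rw [hs, hs] at ht
    refine ⟨z.proj, h1, h2, ?_, ht⟩
    rw [← hlift, ← hlift, hproj hz, hzu]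

end SimpleGraph

/-! ### Lower neighbours in the spheres -/

namespace SimpleGraph

variable {V : Type u} {G : SimpleGraph V} {T : V → V → V → Prop} {o : V}

/-- `d` is a neighbour of `v` which is nearer to the basepoint `o`. -/
def IsLower (G : SimpleGraph V) (o d v : V) : Prop :=
  G.Adj v d ∧ G.dist o d + 1 = G.dist o v

/-- The edges of the spheres around `o`. -/
def IsHorizontal (G : SimpleGraph V) (o u v : V) : Prop :=
  G.Adj u v ∧ G.dist o u = G.dist o v

namespace HasSystolicSpheres

variable (hS : G.HasSystolicSpheres T o) (hT : G.IsLocallySixLarge T)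
include hS

theorem triangle_of_isLower {v a b : V} (ha : G.IsLower o a v) (hb : G.IsLower o b v)
    (h : a ≠ b) : T v a b :=
  hS.lower_triangle ha.1 hb.1 ha.2 hb.2 h

include hT

theorem isHorizontal_of_isLower {v a b : V} (ha : G.IsLower o a v) (hb : G.IsLower o b v)
    (h : a ≠ b) : G.IsHorizontal o a b :=
  ⟨hT.adj (hT.rotate (hS.triangle_of_isLower ha hb h)), by have := ha.2; have := hb.2; omega⟩

/-- Three distinct lower neighbours of `v` would form a triangle in its link. -/
theorem eq_of_isLower {v a b c : V} (ha : G.IsLower o a v) (hb : G.IsLower o b v)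
    (hc : G.IsLower o c v) (hab : a ≠ b) (hac : a ≠ c) : b = c := by
  by_contra hbc
  exact hT.no_three (hS.triangle_of_isLower ha hb hab) (hS.triangle_of_isLower hb hc hbc)
    (hS.triangle_of_isLower hc ha hac.symm)

omit hT in
theorem exists_isLower {u v : V} (h : G.IsHorizontal o u v) :
    ∃ d, G.IsLower o d u ∧ G.IsLower o d v ∧ T u v d := by
  obtain ⟨d, h1, h2, h3, h4⟩ := hS.exists_common_lower h.1 h.2
  exact ⟨d, ⟨h1, h3⟩, ⟨h2, h.2 ▸ h3⟩, h4⟩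

/-- One of `c`, `d` is the apex of a triangle on the edge, since `u` has at most two lower
neighbours. In its link, `u`, `v` and the other one form a triangle. -/
theorem isLower_unique {u v c d : V} (h : G.IsHorizontal o u v) (hc : G.IsLower o c u)
    (hc' : G.IsLower o c v) (hd : G.IsLower o d u) (hd' : G.IsLower o d v) : c = d := by
  by_contra hcd
  obtain ⟨e, he, he', ht⟩ := hS.exists_isLower h
  have h1 := hS.triangle_of_isLower hc hd hcd
  have h2 := hS.triangle_of_isLower hc' hd' hcd
  by_cases hec : c = e
  · subst hec
    exact hT.no_three (hT.rotate' ht) (hT.swap h2) (hT.rotate h1)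
  · obtain rfl := hS.eq_of_isLower hT hc hd he hcd hec
    exact hT.no_three (hT.rotate' ht) (hT.rotate' h2) (hT.reverse h1)

theorem triangle_of_isHorizontal {u v d : V} (h : G.IsHorizontal o u v) (hd : G.IsLower o d u)
    (hd' : G.IsLower o d v) : T u v d := by
  obtain ⟨e, he, he', ht⟩ := hS.exists_isLower h
  obtain rfl := hS.isLower_unique hT h hd hd' he he'
  exact ht

/-- Otherwise `w`, `x`, `b`, `p`, `r` would be a closed path of length five in the link of `z`. This
is what keeps the path of apexes straight. -/
theorem not_isLower_of_isHorizontal {x b z w p r : V} (h : G.IsHorizontal o x b)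
    (hzx : G.IsLower o z x) (hzb : G.IsLower o z b) (hw : G.IsLower o w x) (hwz : w ≠ z)
    (hp : G.IsLower o p b) (hzp : z ≠ p) (hrw : G.IsLower o r w) (hrz : G.IsLower o r z) :
    ¬ G.IsLower o r p := by
  intro hrp
  have h1 := hS.triangle_of_isLower hw hzx hwz
  have h2 := hS.triangle_of_isHorizontal hT h hzx hzb
  have h3 := hS.triangle_of_isLower hzb hp hzp
  have h4 := hS.triangle_of_isHorizontal hT (hS.isHorizontal_of_isLower hT hzb hp hzp) hrz hrp
  have h5 := hS.triangle_of_isHorizontal hT (hS.isHorizontal_of_isLower hT hw hzx hwz) hrw hrz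
  exact hT.no_five (hT.reverse h1) (hT.rotate' h2) (hT.swap h3) h4 (hT.swap' (hT.swap h5))

end HasSystolicSpheres

/-! ### Straight paths in spheres -/

/-- `G.IsStraight o a b c d` says that there is a path in a sphere around `o`, with first edge
`a, b` and last edge `c, d`, of which no two consecutive edges have a common lower neighbour. -/
inductive IsStraight (G : SimpleGraph V) (o : V) : V → V → V → V → Prop
  | edge {a b : V} (h : G.IsHorizontal o a b) : IsStraight G o a b a b
  | tail {a b c d e : V} (h : IsStraight G o a b c d) (h' : G.IsHorizontal o d e)
      (hr : ∀ r, G.IsLower o r c → G.IsLower o r d → ¬ G.IsLower o r e) : IsStraight G o a b d e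

namespace IsStraight

theorem isHorizontal_left {a b c d : V} (h : G.IsStraight o a b c d) : G.IsHorizontal o a b := by
  induction h with
  | edge h => exact h
  | tail _ _ _ ih => exact ih

theorem isHorizontal_right {a b c d : V} (h : G.IsStraight o a b c d) : G.IsHorizontal o c d := by
  cases h with
  | edge h => exact h
  | tail _ h _ => exact h

theorem head {z a b c d : V} (h : G.IsStraight o a b c d) (hz : G.IsHorizontal o z a)
    (hr : ∀ r, G.IsLower o r z → G.IsLower o r a → ¬ G.IsLower o r b) :
    G.IsStraight o z a c d := by
  induction h with
  | edge h => exact .tail (.edge hz) h hr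
  | tail _ h' hr' ih => exact .tail ih h' hr'

variable (hS : G.HasSystolicSpheres T o) (hT : G.IsLocallySixLarge T)
include hS hT

/-- The path from `z` to `w` runs through the apexes of the successive edges. Consecutive apexes
differ because the given path is straight. -/
theorem lower {a b c d : V} (h : G.IsStraight o a b c d) :
    (a = c ∧ b = d) ∨ ∃ z x y w, G.IsStraight o z x y w ∧ G.IsLower o z a ∧ G.IsLower o z b ∧
      G.IsLower o x b ∧ G.IsLower o y c ∧ G.IsLower o w c ∧ G.IsLower o w d := by
  induction h with
  | edge => exact Or.inl ⟨rfl, rfl⟩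
  | @tail c d e h h' hr ih =>
    right
    obtain ⟨w', hwd, hwe, -⟩ := hS.exists_isLower h'
    rcases ih with ⟨rfl, rfl⟩ | ⟨z, x, y, w, hs, hza, hzb, hxb, hyc, hwc, hwd'⟩
    · obtain ⟨z, hza, hzb, -⟩ := hS.exists_isLower h.isHorizontal_left
      have hne : z ≠ w' := fun hh => hr z hza hzb (hh ▸ hwe)
      exact ⟨z, w', z, w', .edge (hS.isHorizontal_of_isLower hT hzb hwd hne), hza, hzb, hwd, hzb,
        hwd, hwe⟩
    · have hne : w ≠ w' := fun hh => hr w hwc hwd' (hh ▸ hwe)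
      refine ⟨z, x, w, w', hs.tail (hS.isHorizontal_of_isLower hT hwd' hwd hne) ?_, hza, hzb, hxb,
        hwd', hwd, hwe⟩
      exact fun r => hS.not_isLower_of_isHorizontal hT h.isHorizontal_right hwc hwd' hyc
        hs.isHorizontal_right.1.ne hwd hne

/-- By induction on the level: the ends of the path of apexes are distinct, and neither of them lies
below the opposite end of the upper path. -/
theorem ne_and_not_adj {a b c d : V} (h : G.IsStraight o a b c d) :
    a ≠ d ∧ (G.Adj a d → a = c ∧ b = d) := by
  induction hn : G.dist o a generalizing a b c d with
  | zero =>
    obtain ⟨z, hz, -⟩ := hS.exists_isLower h.isHorizontal_left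
    have := hz.2
    omega
  | succ n ih =>
    rcases h.lower hS hT with ⟨rfl, rfl⟩ | ⟨z, x, y, w, hs, hza, hzb, hxb, hyc, hwc, hwd⟩
    · exact ⟨h.isHorizontal_left.1.ne, fun _ => ⟨rfl, rfl⟩⟩
    have hab := h.isHorizontal_left
    have hcd := h.isHorizontal_right
    obtain ⟨hzw, hadj⟩ := ih hs (by have := hza.2; omega)
    have hwa : ¬ G.IsLower o w a := fun hwa => by
      obtain ⟨rfl, rfl⟩ := hadj (hS.isHorizontal_of_isLower hT hza hwa hzw).1
      exact hzw (hS.isLower_unique hT hab hza hzb hwa hxb)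
    have hzd : ¬ G.IsLower o z d := fun hzd => by
      obtain ⟨rfl, rfl⟩ := hadj (hS.isHorizontal_of_isLower hT hzd hwd hzw).1
      exact hzw (hS.isLower_unique hT hcd hyc hzd hwc hwd)
    have had : a ≠ d := by
      rintro rfl
      exact hwa hwd
    refine ⟨had, fun hadj' => ?_⟩
    have hdist : G.dist o a = G.dist o d := by
      have h1 := hza.2
      have h2 := hwd.2
      have h3 : ∀ {a b c d}, G.IsStraight o a b c d → G.dist o a = G.dist o d := by
        intro a b c d h
        induction h with
        | edge h => exact h.2
        | tail _ h _ ih => exact ih.trans h.2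
      exact h3 h
    obtain ⟨u, hua, hud, -⟩ := hS.exists_isLower ⟨hadj', hdist⟩
    have huz : u ≠ z := fun hh => hzd (hh ▸ hud)
    have huw : u ≠ w := fun hh => hwa (hh ▸ hua)
    -- Prepending the common lower neighbour `u` of `a` and `d` gives a longer straight path whose
    -- ends `u` and `w` both lie below `d`, hence are adjacent.
    have h1 := hs.head (hS.isHorizontal_of_isLower hT hua hza huz) fun r =>
      hS.not_isLower_of_isHorizontal hT hab hza hzb hua huz hxb hs.isHorizontal_left.1.ne
    exact absurd ((ih h1 (by have := hua.2; omega)).2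
      (hS.isHorizontal_of_isLower hT hud hwd huw).1).2 hzw

/-- Given two common lower neighbours, the last apex `v` is one of them, since `w'` has no third. So
`v` lies below `w` as well and is adjacent to the first apex `z`; the path of apexes is then a
single edge, whose ends both lie below the first edge `w`, `b`. -/
theorem eq_of_isLower {w b c w' x y : V} (h : G.IsStraight o w b c w') (hx : G.IsLower o x w)
    (hx' : G.IsLower o x w') (hy : G.IsLower o y w) (hy' : G.IsLower o y w') : x = y := by
  by_contra hxy
  rcases h.lower hS hT with ⟨rfl, rfl⟩ | ⟨z, p, q, v, hs, hzw, hzb, hpb, hqc, hvc, hvw⟩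
  · exact hxy (hS.isLower_unique hT h.isHorizontal_left hx hx' hy hy')
  · obtain ⟨hzv, hadj⟩ := hs.ne_and_not_adj hS hT
    have hvw' : G.IsLower o v w := by
      by_cases hxv : x = v
      · exact hxv ▸ hx
      · exact hS.eq_of_isLower hT hx' hy' hvw hxy hxv ▸ hy
    obtain ⟨rfl, rfl⟩ := hadj (hS.isHorizontal_of_isLower hT hzw hvw' hzv).1
    exact hzv (hS.isLower_unique hT h.isHorizontal_left hzw hzb hvw' hpb)

/-- The path of apexes is prolonged at each end where the chosen lower neighbour is not already the
extreme apex. -/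
theorem lower_connected {x b c x' w w' : V} (h : G.IsStraight o x b c x') (hw : G.IsLower o w x)
    (hw' : G.IsLower o w' x') : w = w' ∨ ∃ b c, G.IsStraight o w b c w' := by
  have hxb := h.isHorizontal_left
  have hcx := h.isHorizontal_right
  rcases h.lower hS hT with ⟨rfl, rfl⟩ | ⟨z, p, q, v, hs, hzx, hzb, hpb, hqc, hvc, hvx⟩
  · obtain ⟨z, hz, hz', -⟩ := hS.exists_isLower hxb
    by_cases h1 : w = z
    · subst h1
      by_cases h2 : w = w'
      · exact Or.inl h2
      · exact Or.inr ⟨_, _, .edge (hS.isHorizontal_of_isLower hT hz' hw' h2)⟩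
    · have h3 := IsStraight.edge (hS.isHorizontal_of_isLower hT hw hz h1)
      by_cases h2 : z = w'
      · exact Or.inr ⟨_, _, h2 ▸ h3⟩
      · exact Or.inr ⟨_, _, h3.tail (hS.isHorizontal_of_isLower hT hz' hw' h2) fun r =>
          hS.not_isLower_of_isHorizontal hT hxb hz hz' hw h1 hw' h2⟩
  · have h1 : ∃ b, G.IsStraight o w b q v := by
      by_cases h1 : w = z
      · exact ⟨_, h1 ▸ hs⟩
      · exact ⟨_, hs.head (hS.isHorizontal_of_isLower hT hw hzx h1) fun r =>
          hS.not_isLower_of_isHorizontal hT hxb hzx hzb hw h1 hpb hs.isHorizontal_left.1.ne⟩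
    obtain ⟨b', h1⟩ := h1
    by_cases h2 : v = w'
    · exact Or.inr ⟨_, _, h2 ▸ h1⟩
    · exact Or.inr ⟨_, _, h1.tail (hS.isHorizontal_of_isLower hT hvx hw' h2) fun r =>
        hS.not_isLower_of_isHorizontal hT hcx hvc hvx hqc hs.isHorizontal_right.1.ne hw' h2⟩

end IsStraight

/-! ### Levels of an interval -/

/-- The vertices that are reached from `v` by descending towards `o`. -/
def descendants (G : SimpleGraph V) (o v : V) : Set V :=
  {w | Relation.ReflTransGen (fun a b => G.IsLower o b a) v w}

theorem dist_le_of_mem_descendants {v w : V} (h : w ∈ G.descendants o v) :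
    G.dist o w ≤ G.dist o v := by
  induction h with
  | refl => rfl
  | tail _ h ih => have := h.2; omega

theorem HasSystolicSpheres.exists_isStraight (hS : G.HasSystolicSpheres T o)
    (hT : G.IsLocallySixLarge T) {v w w' : V} (hw : w ∈ G.descendants o v)
    (hw' : w' ∈ G.descendants o v) (h : G.dist o w = G.dist o w') :
    w = w' ∨ ∃ b c, G.IsStraight o w b c w' := by
  induction hw generalizing w' with
  | refl =>
    cases hw' with
    | refl => exact Or.inl rfl
    | tail h1 h2 => have := dist_le_of_mem_descendants h1; have := h2.2; omega
  | @tail _ w h1 h2 ih =>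
    cases hw' with
    | refl => have := dist_le_of_mem_descendants h1; have := h2.2; omega
    | @tail x' _ h3 h4 =>
      rcases ih h3 (by have := h2.2; have := h4.2; omega) with rfl | ⟨b, c, hs⟩
      · by_cases hww : w = w'
        · exact Or.inl hww
        · exact Or.inr ⟨_, _, .edge (hS.isHorizontal_of_isLower hT h2 h4 hww)⟩
      · exact hs.lower_connected hS hT h2 h4

theorem HasSystolicSpheres.eq_of_mem_descendants (hS : G.HasSystolicSpheres T o)
    (hT : G.IsLocallySixLarge T) {v w w' a b : V} (hw : w ∈ G.descendants o v)
    (hw' : w' ∈ G.descendants o v) (ha : G.IsLower o a w) (ha' : G.IsLower o a w')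
    (hb : G.IsLower o b w) (hb' : G.IsLower o b w') (hab : a ≠ b) : w = w' := by
  rcases hS.exists_isStraight hT hw hw' (ha.2.symm.trans ha'.2) with h | ⟨_, _, h⟩
  · exact h
  · exact absurd (h.eq_of_isLower hS hT ha ha' hb hb') hab

end SimpleGraph

/-! ### Edge-path homotopies and descent to the basepoint -/

namespace SimpleGraph

variable {V : Type u} {G : SimpleGraph V}

namespace EdgePathHomotopic

variable {C : ∀ {v : V}, G.Walk v v → Prop} {u v w : V}

theorem append_left (r : G.Walk u v) {p q : G.Walk v w} (h : G.EdgePathHomotopic C p q) :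
    G.EdgePathHomotopic C (r.append p) (r.append q) :=
  .append (.refl r) h

theorem append_right {p q : G.Walk u v} (h : G.EdgePathHomotopic C p q) (r : G.Walk v w) :
    G.EdgePathHomotopic C (p.append r) (q.append r) :=
  .append h (.refl r)

theorem cons (h : G.Adj u v) {p q : G.Walk v w} (hpq : G.EdgePathHomotopic C p q) :
    G.EdgePathHomotopic C (.cons h p) (.cons h q) :=
  append_left (.cons h .nil) hpq

theorem cons_cons_symm (h : G.Adj u v) (p : G.Walk u w) :
    G.EdgePathHomotopic C (.cons h (.cons h.symm p)) p :=
  append_right (.backtrack h) p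

theorem append_reverse (p : G.Walk u v) : G.EdgePathHomotopic C (p.append p.reverse) .nil := by
  induction p with
  | nil => exact .refl _
  | cons h p ih =>
    rw [Walk.reverse_cons, Walk.cons_append, Walk.append_assoc]
    exact (cons h (append_right ih _)).trans (.backtrack h)

theorem reverse_append (p : G.Walk u v) : G.EdgePathHomotopic C (p.reverse.append p) .nil := by
  simpa using append_reverse (C := C) p.reverse

theorem of_append_reverse {p q : G.Walk u v} (h : G.EdgePathHomotopic C (p.append q.reverse) .nil) :
    G.EdgePathHomotopic C p q := by
  have h1 := append_left (C := C) p (reverse_append q)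
  have h2 := append_right h q
  rw [Walk.append_assoc] at h1
  rw [Walk.append_nil] at h1
  exact h1.symm.trans h2

end EdgePathHomotopic

theorem IsLower.dist_ne {o d v : V} (h : G.IsLower o d v) : G.dist o v ≠ G.dist o d := by
  have := h.2
  omega

theorem Connected.isLower_or_isLower (hG : G.Connected) {o u v : V} (h : G.Adj u v)
    (hne : G.dist o u ≠ G.dist o v) : G.IsLower o u v ∨ G.IsLower o v u := by
  have h1 := hG.dist_triangle (u := o) (v := u) (w := v)
  have h2 := hG.dist_triangle (u := o) (v := v) (w := u)
  rw [dist_eq_one_iff_adj.2 h] at h1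
  rw [dist_eq_one_iff_adj.2 h.symm] at h2
  rcases lt_or_gt_of_ne hne with h3 | h3
  · exact Or.inl ⟨h.symm, by omega⟩
  · exact Or.inr ⟨h, by omega⟩

theorem Connected.exists_isLower (hG : G.Connected) {o v : V} (h : G.dist o v ≠ 0) :
    ∃ d, G.IsLower o d v := by
  obtain ⟨p, hp⟩ := hG.exists_walk_length_eq_dist v o
  rw [dist_comm] at hp
  cases p with
  | nil => exact absurd hp.symm h
  | @cons _ d _ hd q =>
    refine ⟨d, hd, ?_⟩
    have h1 := dist_le q
    have h2 := hG.dist_triangle (u := v) (v := d) (w := o)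
    rw [dist_eq_one_iff_adj.2 hd, dist_comm (u := v), dist_comm (u := d)] at h2
    rw [dist_comm] at h1
    rw [Walk.length_cons] at hp
    omega

theorem Connected.base_mem_descendants (hG : G.Connected) {o : V} (v : V) :
    o ∈ G.descendants o v := by
  induction hn : G.dist o v generalizing v with
  | zero =>
    obtain rfl := hG.dist_eq_zero_iff.1 hn
    exact .refl
  | succ n ih =>
    obtain ⟨d, hd⟩ := hG.exists_isLower (o := o) (v := v) (by omega)
    exact .head hd (ih d (by have := hd.2; omega))

end SimpleGraph

/-! ### Intervals of the squaring and their simple connectedness -/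

namespace AbstractSimplicialComplex

open SimpleGraph

variable {V : Type u} {Y : AbstractSimplicialComplex V} {o : V}

theorem squaringGraph_adj_of_isLower {d v : V} (h : Y.oneSkeleton.IsLower o d v) :
    (Y.squaringGraph o).Adj v d :=
  ⟨h.1, h.dist_ne⟩

theorem isLower_or_isLower_of_adj (hY : Y.oneSkeleton.Connected) {u v : V}
    (h : (Y.squaringGraph o).Adj u v) :
    Y.oneSkeleton.IsLower o u v ∨ Y.oneSkeleton.IsLower o v u :=
  hY.isLower_or_isLower h.1 h.2

theorem dist_squaringGraph (hY : Y.oneSkeleton.Connected) (v : V) :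
    (Y.squaringGraph o).dist o v = Y.oneSkeleton.dist o v := by
  refine dist_eq_of_descent (by simp) ?_ ?_ ?_ v
  · intro u v h
    rcases isLower_or_isLower_of_adj hY h with h | h <;> · have := h.2; omega
  · intro v hv
    obtain ⟨d, hd⟩ := hY.exists_isLower hv
    exact ⟨d, squaringGraph_adj_of_isLower hd, hd.2⟩
  · intro v hv
    exact ((hY.dist_eq_zero_iff).1 hv).symm

theorem exists_walk_of_mem_descendants {v w : V} (h : w ∈ Y.oneSkeleton.descendants o v) :
    ∃ p : (Y.squaringGraph o).Walk w v,
      Y.oneSkeleton.dist o w + p.length = Y.oneSkeleton.dist o v := by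
  induction h with
  | refl => exact ⟨.nil, rfl⟩
  | tail _ h ih =>
    obtain ⟨p, hp⟩ := ih
    refine ⟨.cons (squaringGraph_adj_of_isLower h).symm p, ?_⟩
    have := h.2
    rw [Walk.length_cons]
    omega

theorem geodesicInterval_squaringGraph (hY : Y.oneSkeleton.Connected) (v : V) :
    (Y.squaringGraph o).geodesicInterval o v = Y.oneSkeleton.descendants o v := by
  classical
  have hlip : ∀ {u v : V} (p : (Y.squaringGraph o).Walk u v),
      Y.oneSkeleton.dist o v ≤ Y.oneSkeleton.dist o u + p.length := by
    intro u v p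
    induction p with
    | nil => simp
    | cons h p ih =>
      rw [Walk.length_cons]
      rcases isLower_or_isLower_of_adj hY h with h | h <;> · have := h.2; omega
  ext w
  constructor
  · rintro ⟨p, hp, hw⟩
    rw [dist_squaringGraph hY] at hp
    -- A walk no longer than the difference of levels must ascend along every edge.
    have h1 : ∀ {u v : V} (p : (Y.squaringGraph o).Walk u v),
        Y.oneSkeleton.dist o u + p.length ≤ Y.oneSkeleton.dist o v →
          u ∈ Y.oneSkeleton.descendants o v := by
      intro u v p hp
      induction p with
      | nil => exact .refl
      | cons h p ih =>
        rw [Walk.length_cons] at hp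
        have := hlip p
        rcases isLower_or_isLower_of_adj hY h with h | h
        · exact .tail (ih (by have := h.2; omega)) h
        · have := h.2
          omega
    refine h1 (p.dropUntil w hw) ?_
    have h2 := congrArg Walk.length (p.take_spec hw)
    rw [Walk.length_append] at h2
    have h3 := dist_le (p.takeUntil w hw)
    rw [dist_squaringGraph hY] at h3
    omega
  · intro h
    obtain ⟨p, hp⟩ := exists_walk_of_mem_descendants h
    obtain ⟨q, hq⟩ := exists_walk_of_mem_descendants (hY.base_mem_descendants (o := o) w)
    rw [dist_self, zero_add] at hq
    refine ⟨q.append p, ?_, ?_⟩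
    · rw [Walk.length_append, dist_squaringGraph hY, hq, hp]
    · rw [Walk.mem_support_append_iff]
      exact Or.inl q.end_mem_support

/-- A full subcomplex of the squaring which contains the basepoint and all lower neighbours of its
vertices is simply connected. -/
theorem simplyConnected_fullSubcomplex {T : V → V → V → Prop}
    (hY : Y.oneSkeleton.Connected) (hS : Y.oneSkeleton.HasSystolicSpheres T o)
    (hT : Y.oneSkeleton.IsLocallySixLarge T) {S : Set V} (ho : o ∈ S)
    (hlow : ∀ {d v : V}, v ∈ S → Y.oneSkeleton.IsLower o d v → d ∈ S) :
    ((Y.squaring o).fullSubcomplex S).graph.EdgePathSimplyConnected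
      ((Y.squaring o).fullSubcomplex S).IsSquareBoundary := by
  set X := (Y.squaring o).fullSubcomplex S
  have hadj : ∀ {u v : S}, X.graph.Adj u v ↔ (Y.squaringGraph o).Adj u v := Iff.rfl
  have hcases : ∀ {u v : S}, X.graph.Adj u v →
      Y.oneSkeleton.IsLower o u.1 v.1 ∨ Y.oneSkeleton.IsLower o v.1 u.1 :=
    fun h => isLower_or_isLower_of_adj hY (hadj.1 h)
  have hex : ∀ u : S, ∃ p : X.graph.Walk u ⟨o, ho⟩, p.length = Y.oneSkeleton.dist o u.1 := by
    intro u
    induction hn : Y.oneSkeleton.dist o u.1 generalizing u with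
    | zero =>
      obtain rfl : u = ⟨o, ho⟩ := Subtype.ext (hY.dist_eq_zero_iff.1 hn).symm
      exact ⟨.nil, rfl⟩
    | succ n ih =>
      obtain ⟨d, hd⟩ := hY.exists_isLower (o := o) (v := u.1) (by omega)
      obtain ⟨p, hp⟩ := ih ⟨d, hlow u.2 hd⟩ (by have := hd.2; dsimp only; omega)
      have hud : X.graph.Adj u ⟨d, hlow u.2 hd⟩ := hadj.2 (squaringGraph_adj_of_isLower hd)
      exact ⟨.cons hud p, by rw [Walk.length_cons, hp]⟩
  have hlen : ∀ {u : S} (p : X.graph.Walk u ⟨o, ho⟩), Y.oneSkeleton.dist o u.1 ≤ p.length := by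
    suffices h : ∀ {u v : S} (p : X.graph.Walk u v),
        Y.oneSkeleton.dist o u.1 ≤ p.length + Y.oneSkeleton.dist o v.1 by
      intro u p
      simpa using h p
    intro u v p
    induction p with
    | nil => simp
    | cons h p ih =>
      rw [Walk.length_cons]
      rcases hcases h with h | h <;> · have := h.2; omega
  -- Two descending walks to `o` are homotopic: distinct first steps `d` and `d'` have a common
  -- lower neighbour `e`, and both walks can be rerouted through `e`, on the two sides of a square.
  have huniq : ∀ (n : ℕ) (u : S), Y.oneSkeleton.dist o u.1 = n →
      ∀ p q : X.graph.Walk u ⟨o, ho⟩, p.length = n → q.length = n →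
        X.graph.EdgePathHomotopic X.IsSquareBoundary p q := by
    intro n
    induction n with
    | zero =>
      intro u hu p q hp hq
      cases p with
      | nil =>
        cases q with
        | nil => exact .refl _
        | cons h q => simp at hq
      | cons h p => simp at hp
    | succ n ih =>
      intro u hu p q hp hq
      cases p with
      | nil => simp at hp
      | @cons _ d _ h p =>
        cases q with
        | nil => simp at hq
        | @cons _ d' _ h' q =>
          rw [Walk.length_cons] at hp hq
          have hd : Y.oneSkeleton.IsLower o d.1 u.1 := by
            have := hlen p
            rcases hcases h with h | h
            · have := h.2; omega
            · exact h
          have hd' : Y.oneSkeleton.IsLower o d'.1 u.1 := by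
            have := hlen q
            rcases hcases h' with h | h
            · have := h.2; omega
            · exact h
          have hdn := hd.2
          have hdn' := hd'.2
          by_cases hdd : d = d'
          · subst hdd
            exact .cons h (ih d (by omega) p q (by omega) (by omega))
          have hdd' : d.1 ≠ d'.1 := fun hh => hdd (Subtype.ext hh)
          obtain ⟨e, he, he', -⟩ :=
            hS.exists_isLower (hS.isHorizontal_of_isLower hT hd hd' hdd')
          have heS : e ∈ S := hlow d.2 he
          have k : X.graph.Adj d ⟨e, heS⟩ := hadj.2 (squaringGraph_adj_of_isLower he)
          have k' : X.graph.Adj d' ⟨e, heS⟩ := hadj.2 (squaringGraph_adj_of_isLower he')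
          obtain ⟨r, hr⟩ := hex ⟨e, heS⟩
          have hen := he.2
          dsimp only at hr
          have hp' := ih d (by omega) p (.cons k r) (by omega) (by rw [Walk.length_cons]; omega)
          have hq' := ih d' (by omega) q (.cons k' r) (by omega) (by rw [Walk.length_cons]; omega)
          refine (EdgePathHomotopic.cons h hp').trans
            (.trans ?_ (EdgePathHomotopic.cons h' hq').symm)
          have hsq : X.graph.EdgePathHomotopic X.IsSquareBoundary
              (.cons h (.cons k .nil)) (.cons h' (.cons k' .nil)) := by
            refine .of_append_reverse (.cell _ ?_)
            refine ⟨d, ⟨e, heS⟩, d', h, k, k'.symm, h'.symm, ?_, rfl⟩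
            refine ⟨⟨hadj.1 h, hadj.1 k, hadj.1 k'.symm, hadj.1 h'.symm⟩, ?_, hdd'⟩
            rintro rfl
            omega
          exact hsq.append_right r
  choose c hc using hex
  -- Any walk is absorbed, edge by edge, into the chosen descending walks: a descending edge
  -- prolongs one, and an ascending edge is cancelled by a backtrack.
  have hloop : ∀ {u v : S} (p : X.graph.Walk u v),
      X.graph.EdgePathHomotopic X.IsSquareBoundary (p.append (c v)) (c u) := by
    intro u v p
    induction p with
    | nil => exact .refl _
    | @cons u w v h p ih =>
      refine (EdgePathHomotopic.cons h ih).trans ?_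
      rcases hcases h with h1 | h1
      · have h2 := huniq _ w rfl (c w) (.cons h.symm (c u)) (hc w)
          (by rw [Walk.length_cons, hc]; exact h1.2)
        exact (EdgePathHomotopic.cons h h2).trans (.cons_cons_symm h (c u))
      · exact huniq _ u rfl _ _ (by rw [Walk.length_cons, hc]; exact h1.2) (hc u)
  refine ⟨?_, fun v p => ?_⟩
  · have : Nonempty S := ⟨⟨o, ho⟩⟩
    exact ⟨fun u v => ⟨(c u).append (c v).reverse⟩⟩
  · have h1 := (hloop p).append_right (c v).reverse
    rw [← Walk.append_assoc] at h1
    have h2 := EdgePathHomotopic.append_left p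
      (EdgePathHomotopic.append_reverse (C := X.IsSquareBoundary) (c v))
    rw [Walk.append_nil] at h2
    exact h2.symm.trans (h1.trans (.append_reverse _))

/-! ### Common neighbours and links in an interval -/

section Links

variable {T : V → V → V → Prop} (hY : Y.oneSkeleton.Connected)
  (hS : Y.oneSkeleton.HasSystolicSpheres T o) (hT : Y.oneSkeleton.IsLocallySixLarge T)
include hY hS hT

/-- If `a` and `b` have equal level, two of the three common neighbours lie on the same side of both
and so coincide. Otherwise the levels differ by two, and the higher vertex has three lower
neighbours. -/
theorem eq_or_eq_or_eq_of_adj {v a b c₁ c₂ c₃ : V}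
    (ha : a ∈ Y.oneSkeleton.descendants o v) (hb : b ∈ Y.oneSkeleton.descendants o v)
    (hc₁ : c₁ ∈ Y.oneSkeleton.descendants o v) (hc₂ : c₂ ∈ Y.oneSkeleton.descendants o v)
    (hc₃ : c₃ ∈ Y.oneSkeleton.descendants o v) (hab : a ≠ b)
    (ha₁ : (Y.squaringGraph o).Adj a c₁) (hb₁ : (Y.squaringGraph o).Adj b c₁)
    (ha₂ : (Y.squaringGraph o).Adj a c₂) (hb₂ : (Y.squaringGraph o).Adj b c₂)
    (ha₃ : (Y.squaringGraph o).Adj a c₃) (hb₃ : (Y.squaringGraph o).Adj b c₃) :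
    c₁ = c₂ ∨ c₁ = c₃ ∨ c₂ = c₃ := by
  have up : ∀ {c c' : V}, c ∈ Y.oneSkeleton.descendants o v → c' ∈ Y.oneSkeleton.descendants o v →
      Y.oneSkeleton.IsLower o a c → Y.oneSkeleton.IsLower o b c → Y.oneSkeleton.IsLower o a c' →
      Y.oneSkeleton.IsLower o b c' → c = c' :=
    fun hc hc' h1 h2 h3 h4 => hS.eq_of_mem_descendants hT hc hc' h1 h3 h2 h4 hab
  have down : ∀ {c c' : V}, Y.oneSkeleton.IsLower o c a → Y.oneSkeleton.IsLower o c b →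
      Y.oneSkeleton.IsLower o c' a → Y.oneSkeleton.IsLower o c' b → c = c' := by
    intro c c' h1 h2 h3 h4
    by_contra hcc
    exact hab (hS.eq_of_mem_descendants hT ha hb h1 h2 h3 h4 hcc)
  by_contra! hne
  obtain ⟨h12, h13, h23⟩ := hne
  rcases isLower_or_isLower_of_adj hY ha₁ with a1 | a1 <;>
  rcases isLower_or_isLower_of_adj hY hb₁ with b1 | b1 <;>
  rcases isLower_or_isLower_of_adj hY ha₂ with a2 | a2 <;>
  rcases isLower_or_isLower_of_adj hY hb₂ with b2 | b2 <;>
  rcases isLower_or_isLower_of_adj hY ha₃ with a3 | a3 <;>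
  rcases isLower_or_isLower_of_adj hY hb₃ with b3 | b3 <;>
  first
  | exact h12 (up hc₁ hc₂ a1 b1 a2 b2)
  | exact h13 (up hc₁ hc₃ a1 b1 a3 b3)
  | exact h23 (up hc₂ hc₃ a2 b2 a3 b3)
  | exact h12 (down a1 b1 a2 b2)
  | exact h13 (down a1 b1 a3 b3)
  | exact h23 (down a2 b2 a3 b3)
  | exact h23 (hS.eq_of_isLower hT a1 a2 a3 h12 h13)
  | exact h23 (hS.eq_of_isLower hT b1 b2 b3 h12 h13)
  | (have := a1.2; have := a2.2; have := a3.2; have := b1.2; have := b2.2; have := b3.2; omega)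

/-- The corner at `x` of a square of an interval, one side of which descends from `x` while the
other one ascends. -/
theorem exists_of_square_of_isLower_of_isLower {x a b z : V} (ha : Y.oneSkeleton.IsLower o a x)
    (hb : Y.oneSkeleton.IsLower o x b) (h : (Y.squaring o).IsSquare x a z b) :
    Y.oneSkeleton.IsLower o a z ∧ Y.oneSkeleton.IsLower o z b ∧ T x a z ∧ T x z b := by
  obtain ⟨⟨-, haz, hzb, -⟩, hxz, -⟩ := h
  have h1 := ha.2
  have h2 := hb.2
  have hz : Y.oneSkeleton.IsLower o a z ∧ Y.oneSkeleton.IsLower o z b := by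
    rcases isLower_or_isLower_of_adj hY haz with h3 | h3 <;>
    rcases isLower_or_isLower_of_adj hY hzb with h4 | h4
    · exact ⟨h3, h4⟩
    all_goals
      have := h3.2
      have := h4.2
      omega
  have h3 := hS.triangle_of_isLower hb hz.2 hxz
  exact ⟨hz.1, hz.2, hT.swap' (hS.triangle_of_isHorizontal hT
    (hS.isHorizontal_of_isLower hT hb hz.2 hxz) ha hz.1), hT.rotate h3⟩

/-- The corner `z` cannot lie below `a` and `b`, for then they would have two common lower
neighbours. So it lies above both, which makes them adjacent, with `x` as their apex. -/
theorem triangle_of_square_of_isLower_of_isLower {v x a b z : V}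
    (hav : a ∈ Y.oneSkeleton.descendants o v) (hbv : b ∈ Y.oneSkeleton.descendants o v)
    (ha : Y.oneSkeleton.IsLower o x a)
    (hb : Y.oneSkeleton.IsLower o x b) (h : (Y.squaring o).IsSquare x a z b) : T x a b := by
  obtain ⟨⟨-, haz, hzb, -⟩, hxz, hab⟩ := h
  have h1 := ha.2
  have h2 := hb.2
  rcases isLower_or_isLower_of_adj hY haz with h3 | h3 <;>
  rcases isLower_or_isLower_of_adj hY hzb with h4 | h4
  · have := h3.2
    have := h4.2
    omega
  · exact hT.rotate' (hS.triangle_of_isHorizontal hT (hS.isHorizontal_of_isLower hT h3 h4 hab)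
      ha hb)
  · exact absurd (hS.eq_of_mem_descendants hT hav hbv ha hb h3 h4 hxz) hab
  · have := h3.2
    have := h4.2
    omega

/-- The cases are the numbers of lower vertices among `a`, `b`, `c`. Three exceed the maximum of
two, two contradict the uniqueness of a common lower neighbour, and one or none yields a closed path
of length five or three in the link of `x` in `Y`. -/
theorem not_square_triangle {v x a b c z₁ z₂ z₃ : V}
    (ha : a ∈ Y.oneSkeleton.descendants o v) (hb : b ∈ Y.oneSkeleton.descendants o v)
    (hc : c ∈ Y.oneSkeleton.descendants o v)
    (hab : (Y.squaring o).IsSquare x a z₁ b) (hbc : (Y.squaring o).IsSquare x b z₂ c)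
    (hca : (Y.squaring o).IsSquare x c z₃ a) : False := by
  have flip : ∀ {a b z : V}, (Y.squaring o).IsSquare x a z b → (Y.squaring o).IsSquare x b z a :=
    fun h => (Y.squaring o).rotate ((Y.squaring o).rotate ((Y.squaring o).rotate
      ((Y.squaring o).reflect h)))
  have two_lower : ∀ {a b c z z' : V}, Y.oneSkeleton.IsLower o a x → Y.oneSkeleton.IsLower o b x →
      Y.oneSkeleton.IsLower o x c → a ≠ b → (Y.squaring o).IsSquare x a z c →
      (Y.squaring o).IsSquare x b z' c → False := by
    intro a b c z z' ha hb hc hab h h'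
    obtain ⟨h1, h2, -, -⟩ := exists_of_square_of_isLower_of_isLower hY hS hT ha hc h
    obtain ⟨h3, h4, -, -⟩ := exists_of_square_of_isLower_of_isLower hY hS hT hb hc h'
    obtain rfl := hS.eq_of_isLower hT hc h2 h4 h.2.1 h'.2.1
    exact hab (hS.isLower_unique hT (hS.isHorizontal_of_isLower hT hc h2 h.2.1) ha h1 hb h3)
  have one_lower : ∀ {a b c z z' w : V}, b ∈ Y.oneSkeleton.descendants o v →
      c ∈ Y.oneSkeleton.descendants o v → Y.oneSkeleton.IsLower o a x →
      Y.oneSkeleton.IsLower o x b → Y.oneSkeleton.IsLower o x c → (Y.squaring o).IsSquare x a z b →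
      (Y.squaring o).IsSquare x a z' c → (Y.squaring o).IsSquare x b w c → False := by
    intro a b c z z' w hb hc ha hxb hxc h h' h''
    obtain ⟨-, -, h1, h2⟩ := exists_of_square_of_isLower_of_isLower hY hS hT ha hxb h
    obtain ⟨-, -, h3, h4⟩ := exists_of_square_of_isLower_of_isLower hY hS hT ha hxc h'
    exact hT.no_five h1 h2 (triangle_of_square_of_isLower_of_isLower hY hS hT hb hc hxb hxc h'')
      (hT.swap' h4) (hT.swap' h3)
  have nab : a ≠ b := hab.2.2
  have nbc : b ≠ c := hbc.2.2
  have nca : c ≠ a := hca.2.2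
  rcases isLower_or_isLower_of_adj hY hab.1.1.symm with a1 | a1 <;>
  rcases isLower_or_isLower_of_adj hY hbc.1.1.symm with b1 | b1 <;>
  rcases isLower_or_isLower_of_adj hY hca.1.1.symm with c1 | c1
  · exact nbc (hS.eq_of_isLower hT a1 b1 c1 nab nca.symm)
  · exact two_lower a1 b1 c1 nab (flip hca) hbc
  · exact two_lower c1 a1 b1 nca (flip hbc) hab
  · exact one_lower hb hc a1 b1 c1 hab (flip hca) hbc
  · exact two_lower b1 c1 a1 nbc (flip hab) hca
  · exact one_lower hc ha b1 c1 a1 hbc (flip hab) hca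
  · exact one_lower ha hb c1 a1 b1 hca (flip hbc) hab
  · exact hT.no_three (triangle_of_square_of_isLower_of_isLower hY hS hT ha hb a1 b1 hab)
      (triangle_of_square_of_isLower_of_isLower hY hS hT hb hc b1 c1 hbc)
      (triangle_of_square_of_isLower_of_isLower hY hS hT hc ha c1 a1 hca)

end Links

end AbstractSimplicialComplex

/-! ### Girth and short closed walks -/

namespace SimpleGraph

variable {V : Type u} {H : SimpleGraph V}

theorem not_adj_of_four_le_egirth (h : 4 ≤ H.egirth) {a b c : V} (hab : H.Adj a b)
    (hbc : H.Adj b c) (hca : H.Adj c a) : False := by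
  have h1 : (Walk.cons hab (.cons hbc (.cons hca .nil))).IsCycle := by
    simp [Walk.cons_isCycle_iff, hab.ne, hab.ne', hbc.ne, hca.ne, hca.ne']
  have h2 := h.trans (egirth_le_length h1)
  simp only [Walk.length_cons, Walk.length_nil] at h2
  norm_cast at h2

theorem eq_or_eq_of_five_le_egirth (h : 5 ≤ H.egirth) {a b c d : V} (hab : H.Adj a b)
    (hbc : H.Adj b c) (hcd : H.Adj c d) (hda : H.Adj d a) : a = c ∨ b = d := by
  by_contra! hne
  have h1 : (Walk.cons hab (.cons hbc (.cons hcd (.cons hda .nil)))).IsCycle := by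
    simp [Walk.cons_isCycle_iff, hab.ne, hab.ne', hbc.ne, hcd.ne, hda.ne, hda.ne', hne.1,
      hne.1.symm, hne.2]
  have h2 := h.trans (egirth_le_length h1)
  simp only [Walk.length_cons, Walk.length_nil] at h2
  norm_cast at h2

theorem not_adj_of_six_le_egirth (h : 6 ≤ H.egirth) {a b c d e : V} (hab : H.Adj a b)
    (hbc : H.Adj b c) (hcd : H.Adj c d) (hde : H.Adj d e) (hea : H.Adj e a) : False := by
  have h4 : 4 ≤ H.egirth := le_trans (by norm_num) h
  -- A closed walk of length five is embedded here: identifying two of its vertices would leave a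
  -- triangle.
  have hac : a ≠ c := fun hh => not_adj_of_four_le_egirth h4 hcd hde (hh ▸ hea)
  have hbd : b ≠ d := fun hh => not_adj_of_four_le_egirth h4 hde hea (hh ▸ hab)
  have hce : c ≠ e := fun hh => not_adj_of_four_le_egirth h4 hea hab (hh ▸ hbc)
  have hda : d ≠ a := fun hh => not_adj_of_four_le_egirth h4 hab hbc (hh ▸ hcd)
  have heb : e ≠ b := fun hh => not_adj_of_four_le_egirth h4 hbc hcd (hh ▸ hde)
  have h1 : (Walk.cons hab (.cons hbc (.cons hcd (.cons hde (.cons hea .nil))))).IsCycle := by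
    simp [Walk.cons_isCycle_iff, hab.ne, hab.ne', hbc.ne, hcd.ne, hde.ne, hea.ne, hea.ne', hac,
      hac.symm, hbd, hce, hda, hda.symm, heb.symm]
  have h2 := h.trans (egirth_le_length h1)
  simp only [Walk.length_cons, Walk.length_nil] at h2
  norm_cast at h2

theorem four_le_egirth (h : ∀ a b c : V, H.Adj a b → H.Adj b c → H.Adj c a → False) :
    4 ≤ H.egirth := by
  rw [le_egirth]
  intro a w hw
  have h3 := hw.three_le_length
  by_contra hlt
  have hlt' : w.length < 4 := by exact_mod_cast not_le.1 hlt
  match w with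
  | .nil => simp at h3
  | .cons _ .nil => simp at h3
  | .cons _ (.cons _ .nil) => simp at h3
  | .cons h1 (.cons h2 (.cons h4 .nil)) => exact h _ _ _ h1 h2 h4
  | .cons _ (.cons _ (.cons _ (.cons _ p))) => simp at hlt'; omega

end SimpleGraph

/-! ### Conclusion for two-dimensional systolic complexes -/

namespace AbstractSimplicialComplex

open SimpleGraph

variable {V : Type u} {Y : AbstractSimplicialComplex V}

open Classical in
/-- Three vertices span a 2-simplex. -/
def IsTriangle (Y : AbstractSimplicialComplex V) (a b c : V) : Prop :=
  a ≠ b ∧ b ≠ c ∧ a ≠ c ∧ ({a, b, c} : Finset V) ∈ Y.faces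

namespace IsTriangle

variable {a b c : V}

theorem rotate (h : Y.IsTriangle a b c) : Y.IsTriangle b c a := by
  refine ⟨h.2.1, h.2.2.1.symm, h.1.symm, ?_⟩
  convert h.2.2.2 using 1
  ext x
  simp only [Finset.mem_insert, Finset.mem_singleton]
  tauto

theorem swap (h : Y.IsTriangle a b c) : Y.IsTriangle b a c := by
  refine ⟨h.1.symm, h.2.2.1, h.2.1, ?_⟩
  convert h.2.2.2 using 1
  ext x
  simp only [Finset.mem_insert, Finset.mem_singleton]
  tauto

theorem adj (h : Y.IsTriangle a b c) : Y.oneSkeleton.Adj a b := by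
  classical
  refine ⟨h.1, (Y.isRelLowerSet_faces h.2.2.2).2 ?_ (by simp)⟩
  intro x
  simp only [Finset.mem_insert, Finset.mem_singleton]
  tauto

theorem link_adj {v : V} (h : Y.IsTriangle v a b) (ha : a ∈ Y.oneSkeleton.neighborSet v)
    (hb : b ∈ Y.oneSkeleton.neighborSet v) : (Y.linkGraph v).Adj ⟨a, ha⟩ ⟨b, hb⟩ :=
  ⟨fun hh => h.2.1 (congrArg Subtype.val hh), h.2.2.2⟩

end IsTriangle

theorem IsTwoDimSystolic.isLocallySixLarge (hY : Y.IsTwoDimSystolic) :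
    Y.oneSkeleton.IsLocallySixLarge Y.IsTriangle where
  adj := IsTriangle.adj
  rotate := IsTriangle.rotate
  swap := IsTriangle.swap
  no_three h1 h2 h3 :=
    not_adj_of_four_le_egirth (le_trans (by norm_num) (hY.six_le_girth _))
      (h1.link_adj h1.adj h2.adj) (h2.link_adj _ h3.adj) (h3.link_adj _ _)
  no_four h1 h2 h3 h4 := by
    have := eq_or_eq_of_five_le_egirth (le_trans (by norm_num) (hY.six_le_girth _))
      (h1.link_adj h1.adj h2.adj) (h2.link_adj _ h3.adj) (h3.link_adj _ h4.adj) (h4.link_adj _ _)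
    exact this.imp (congrArg Subtype.val) (congrArg Subtype.val)
  no_five h1 h2 h3 h4 h5 :=
    not_adj_of_six_le_egirth (hY.six_le_girth _)
      (h1.link_adj h1.adj h2.adj) (h2.link_adj _ h3.adj) (h3.link_adj _ h4.adj)
      (h4.link_adj _ h5.adj) (h5.link_adj _ _)

theorem IsTwoDimSystolic.hasSystolicSpheres (hY : Y.IsTwoDimSystolic) (o : V) :
    Y.oneSkeleton.HasSystolicSpheres Y.IsTriangle o := by
  refine hY.isLocallySixLarge.hasSystolicSpheres ?_ hY.simplyConnected o
  rintro v c ⟨a, b, h₁, h₂, h₃, h, rfl⟩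
  exact ⟨a, b, h₁, h₂, h₃, ⟨h₁.ne, h₂.ne, h₃.ne', h⟩, rfl⟩

variable {o v : V}

theorem IsTwoDimSystolic.mem_descendants (hY : Y.IsTwoDimSystolic)
    (w : (Y.squaring o).graph.geodesicInterval o v) :
    w.1 ∈ Y.oneSkeleton.descendants o v := by
  rw [← geodesicInterval_squaringGraph hY.simplyConnected.1]
  exact w.2

theorem IsTwoDimSystolic.eq_or_eq_or_eq_of_interval_adj (hY : Y.IsTwoDimSystolic)
    {a b c₁ c₂ c₃ : (Y.squaring o).graph.geodesicInterval o v} (hab : a ≠ b)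
    (ha₁ : ((Y.squaring o).interval o v).graph.Adj a c₁)
    (hb₁ : ((Y.squaring o).interval o v).graph.Adj b c₁)
    (ha₂ : ((Y.squaring o).interval o v).graph.Adj a c₂)
    (hb₂ : ((Y.squaring o).interval o v).graph.Adj b c₂)
    (ha₃ : ((Y.squaring o).interval o v).graph.Adj a c₃)
    (hb₃ : ((Y.squaring o).interval o v).graph.Adj b c₃) : c₁ = c₂ ∨ c₁ = c₃ ∨ c₂ = c₃ := by
  simp only [Subtype.ext_iff]
  exact eq_or_eq_or_eq_of_adj hY.simplyConnected.1 (hY.hasSystolicSpheres o) hY.isLocallySixLarge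
    (hY.mem_descendants a) (hY.mem_descendants b) (hY.mem_descendants c₁) (hY.mem_descendants c₂)
    (hY.mem_descendants c₃) (fun h => hab (Subtype.ext h)) ha₁ hb₁ ha₂ hb₂ ha₃ hb₃

theorem IsTwoDimSystolic.hasFlatIntervals (hY : Y.IsTwoDimSystolic) (o : V) :
    (Y.squaring o).HasFlatIntervals o := by
  have hc := hY.simplyConnected.1
  have hS := hY.hasSystolicSpheres o
  have hT := hY.isLocallySixLarge
  intro v
  have hI := geodesicInterval_squaringGraph (o := o) hc v
  refine ⟨simplyConnected_fullSubcomplex hc hS hT ?_ ?_, ?_, ?_⟩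
  · exact (Set.ext_iff.1 hI o).2 (hc.base_mem_descendants v)
  · intro d w hw hd
    exact (Set.ext_iff.1 hI d).2 (.tail ((Set.ext_iff.1 hI w).1 hw) hd)
  · rintro x a b c c' ⟨⟨hxa, hac, hcb, hbx⟩, hxc, hab⟩ ⟨⟨-, hac', hcb', -⟩, hxc', -⟩
    -- Two squares on the same corner give `a` and `b` the common neighbours `x`, `c` and `c'`.
    rcases hY.eq_or_eq_or_eq_of_interval_adj (a := a) (b := b) (c₁ := x) (c₂ := c) (c₃ := c')
      (fun h => hab (congrArg Subtype.val h)) hxa.symm hbx hac hcb.symm hac' hcb'.symm with h | h | h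
    · exact absurd (congrArg Subtype.val h) hxc
    · exact absurd (congrArg Subtype.val h) hxc'
    · exact h
  · intro x
    refine four_le_egirth ?_
    rintro a b c ⟨z₁, h₁⟩ ⟨z₂, h₂⟩ ⟨z₃, h₃⟩
    exact not_square_triangle hc hS hT (hY.mem_descendants a.1) (hY.mem_descendants b.1)
      (hY.mem_descendants c.1) h₁ h₂ h₃

theorem IsTwoDimSystolic.completeBipartiteGraph_free (hY : Y.IsTwoDimSystolic) (o v : V) :
    (completeBipartiteGraph (Fin 2) (Fin 3)).Free ((Y.squaring o).interval o v).graph := by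
  rintro ⟨f⟩
  have hadj : ∀ (i : Fin 2) (j : Fin 3),
      ((Y.squaring o).interval o v).graph.Adj (f (.inl i)) (f (.inr j)) :=
    fun i j => f.toHom.map_adj (by simp)
  have hinj : ∀ {x y}, f x = f y → x = y := fun h => f.injective h
  rcases hY.eq_or_eq_or_eq_of_interval_adj (fun h => by simpa using hinj h) (hadj 0 0) (hadj 1 0)
    (hadj 0 1) (hadj 1 1) (hadj 0 2) (hadj 1 2) with h | h | h <;> simpa using hinj h

end AbstractSimplicialComplex

theorem mainTheorem5 {V : Type*} (Y : AbstractSimplicialComplex V) (hY : Y.IsTwoDimSystolic)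
    (o : V) :
    (Y.squaring o).HasFlatIntervals o ∧
      ∀ v : V, (completeBipartiteGraph (Fin 2) (Fin 3)).Free ((Y.squaring o).interval o v).graph :=
  ⟨hY.hasFlatIntervals o, hY.completeBipartiteGraph_free o⟩
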